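/- Let $\mathsf H_m=\sum_{j=1}^m\frac1j$ (so $\mathsf H_0=0$) and let $$L=L\left(2,\left(\tfrac{-8}{\cdot}\right)\right)=\sum_{n=1}^\infty\left(\frac{-8}{n}\right)\frac1{n^2},$$ where $\left(\frac{-8}{\cdot}\right)$ is the Kronecker symbol. Then the following five series converge absolutely and have the indicated sums: \begin{align*} \sum_{k=0}^\infty\frac{(350k-17)\binom{2k}k8^k}{\binom{3k}k\binom{6k}{3k}}&=15\sqrt2\,\pi+27,\\ \sum_{k=1}^\infty\frac{\left[21(350k-17)(2\mathsf H_{6k-1}-\mathsf H_{3k-1}-\mathsf H_{k-1})+4850\right]\binom{2k}k8^k}{\binom{3k}k\binom{6k}{3k}}&=976+1020\sqrt2\,\pi+945\sqrt2\,\pi\log2,\\ \sum_{k=1}^\infty\frac{\left[7(350k-17)(\mathsf H_{2k-1}-\mathsf H_{k-1})+2225\right]\binom{2k}k8^k}{\binom{3k}k\binom{6k}{3k}}&=276+\frac{493\pi}{\sqrt2}+\frac{315\pi\log2}{\sqrt2}-420L,\\ \sum_{k=1}^\infty\frac{\left[(50k-7)(\mathsf H_{2k-1}-\mathsf H_{k-1})+5\right]\binom{2k}k8^k}{k\binom{3k}k\binom{6k}{3k}}&=3\sqrt2\,\pi(1+\log2)-8L,\\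 \sum_{k=1}^\infty\frac{\left[(50k-7)(2\mathsf H_{6k-1}-\mathsf H_{3k-1}-\mathsf H_{k-1})-10\right]\binom{2k}k8^k}{k\binom{3k}k\binom{6k}{3k}}&=2\sqrt2\,\pi(2+3\log2). \end{align*} -/

import Mathlib

/-- The Kronecker symbol `(a / n)` for an integer `a` and a positive integer `n`: if `n = 2 ^ e * m`
with `m` odd, it is `(a / 2) ^ e * (a / m)`, where `(a / m)` is the Jacobi symbol and `(a / 2)` is
`0` for even `a`, `1` for `a ≡ ±1 (mod 8)` and `-1` for `a ≡ ±3 (mod 8)`. -/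
def kroneckerSymbol (a : ℤ) (n : ℕ+) : ℤ :=
  ZMod.χ₈ (a : ZMod 8) ^ (n : ℕ).factorization 2 *
    jacobiSym a ((n : ℕ) / 2 ^ (n : ℕ).factorization 2)

/-- The Kronecker symbol `(-8 / ·)` is the odd primitive quadratic Dirichlet character modulo 8. -/
theorem kroneckerSymbol_neg_eight (n : ℕ+) :
    kroneckerSymbol (-8) n = ZMod.χ₈' ((n : ℕ) : ZMod 8) := by
  unfold kroneckerSymbol
  rcases Nat.even_or_odd (n : ℕ) with hn | hn
  · have h2 : 2 ∣ (n : ℕ) := hn.two_dvd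
    have he : (n : ℕ).factorization 2 ≠ 0 :=
      (Nat.prime_two.factorization_pos_of_dvd n.ne_zero h2).ne'
    have h0 : ZMod.χ₈ ((-8 : ℤ) : ZMod 8) = 0 := by decide
    rw [h0, zero_pow he, zero_mul, ZMod.χ₈'_nat_eq_if_mod_eight,
      if_pos (Nat.even_iff.mp hn)]
  · have h2 : ¬ 2 ∣ (n : ℕ) := hn.not_two_dvd_nat
    rw [Nat.factorization_eq_zero_of_not_dvd h2, pow_zero, one_mul, pow_zero, Nat.div_one,
      show (-8 : ℤ) = -2 * 4 by norm_num, jacobiSym.mul_left, jacobiSym.at_four hn, mul_one,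
      jacobiSym.at_neg_two hn]

/-- The series defining `L(2, (-8 / ·))` converges absolutely. -/
theorem summable_kroneckerSymbol_neg_eight :
    Summable fun n : ℕ+ => (kroneckerSymbol (-8) n : ℝ) / ((n : ℕ) : ℝ) ^ 2 := by
  have h : Summable fun n : ℕ+ => 1 / ((n : ℕ) : ℝ) ^ 2 :=
    (Real.summable_one_div_nat_pow.mpr one_lt_two).comp_injective PNat.coe_injective
  refine Summable.of_norm_bounded h fun n => ?_
  rw [norm_div, norm_pow, Real.norm_natCast]
  gcongr
  rw [kroneckerSymbol_neg_eight, ZMod.χ₈'_nat_eq_if_mod_eight]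
  split_ifs <;> simp

/-- The value `L(2, (-8 / ·)) = ∑_{n ≥ 1} (-8 / n) / n ^ 2` of the Dirichlet `L`-function. -/
noncomputable def LTwoNegEight : ℝ :=
  ∑' n : ℕ+, (kroneckerSymbol (-8) n : ℝ) / ((n : ℕ) : ℝ) ^ 2

/-- The harmonic number `H_m = ∑_{j = 1}^m 1 / j`, as a real number. -/
noncomputable def Hnum (m : ℕ) : ℝ := (harmonic m : ℝ)

/-- The weight `C(2k, k) 8 ^ k / (C(3k, k) C(6k, 3k))`. -/
noncomputable def binomWeight (k : ℕ) : ℝ :=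
  ((2 * k).choose k * 8 ^ k : ℝ) / ((3 * k).choose k * (6 * k).choose (3 * k))

/-!
The weight `binomWeight k / k` is, up to the factor `4 · 2 ^ (-k)`, the beta integral
`∫₀¹ y ^ (2k) (1 - y²) ^ (2k - 1) dy`. Differentiating this integral in its two exponents multiplies
the integrand by a combination of `log y` and `log (1 - y²)`, and the value by harmonic numbers.
Summing over `k` under the integral sign therefore turns each series into `∫₀¹ R` or
`∫₀¹ (R (2c log 2 + 2 log y - c log (1 - y²)) + C)` with `c = 1, 2`, where `R` and `C` are rational
with denominator a power of `2 - y² (1 - y²)² = (2 - y²) (1 + y⁴)`.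

For the polynomial factors that occur, `R` is the derivative of a rational function plus a multiple
of `w = (1 + y²) / (1 + y⁴)`. Integration by parts removes the derivative together with its
logarithm, and the additive constants in the series are such that the remaining rational integral is
again a rational number plus a multiple of `∫₀¹ w`. There remain
* `∫₀¹ w = π / (2√2)`, by the substitution `v = (1 - y²) / (√2 y)`, which maps `w dy` to
  `-dv / (√2 (1 + v²))`;
* `∫₀¹ w log y = -L`, since `w = ∑ (-8 / (n + 1)) y ^ n`;
* `∫₀¹ w log (1 - y²)`, which the same substitution reduces to the previous one, because
  `∫₀^∞ log v / (1 + v²) dv = 0`.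
-/

open MeasureTheory Set Real

/-! ### Harmonic numbers -/

/-- The sum `1 + 1/3 + ⋯ + 1/(2n - 1)`. -/
noncomputable def oddHarmonic (n : ℕ) : ℝ := ∑ j ∈ Finset.range n, 1 / (2 * (j : ℝ) + 1)

theorem oddHarmonic_succ (n : ℕ) :
    oddHarmonic (n + 1) = oddHarmonic n + 1 / (2 * (n : ℝ) + 1) := by
  simp [oddHarmonic, Finset.sum_range_succ]

theorem Hnum_zero : Hnum 0 = 0 := by simp [Hnum]

theorem Hnum_succ (n : ℕ) : Hnum (n + 1) = Hnum n + 1 / ((n : ℝ) + 1) := by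
  simp [Hnum, harmonic_succ]

theorem two_mul_oddHarmonic (n : ℕ) : 2 * oddHarmonic n = 2 * Hnum (2 * n) - Hnum n := by
  induction n with
  | zero => simp [oddHarmonic, Hnum_zero]
  | succ n ih =>
    rw [oddHarmonic_succ, show 2 * (n + 1) = 2 * n + 1 + 1 by ring, Hnum_succ, Hnum_succ, Hnum_succ,
      mul_add, ih]
    push_cast
    rw [show 2 * (n : ℝ) + 1 + 1 = 2 * (n + 1) by ring]
    field_simp
    ring

theorem two_mul_oddHarmonic_succ (n : ℕ) :
    2 * oddHarmonic (n + 1) = 2 * Hnum (2 * n + 1) - Hnum n := by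
  rw [two_mul_oddHarmonic, Hnum_succ n, show 2 * (n + 1) = 2 * n + 1 + 1 by ring, Hnum_succ]
  push_cast
  rw [show 2 * (n : ℝ) + 1 + 1 = 2 * (n + 1) by ring]
  field_simp
  ring

/-- The harmonic factor of the series, as a function of a parameter `c`: it is
`H_{2k-1} - H_{k-1}` for `c = 1` and `2 H_{6k-1} - H_{3k-1} - H_{k-1}` for `c = 2`. -/
noncomputable def harmonicFactor (c : ℝ) (k : ℕ) : ℝ :=
  2 * oddHarmonic k + (2 * c - 2) * oddHarmonic (3 * k) - c * Hnum (2 * k - 1)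

theorem harmonicFactor_one_succ (k : ℕ) :
    harmonicFactor 1 (k + 1) = Hnum (2 * (k + 1) - 1) - Hnum k := by
  rw [harmonicFactor, two_mul_oddHarmonic_succ, show 2 * (k + 1) - 1 = 2 * k + 1 by lia]
  ring

theorem harmonicFactor_two_succ (k : ℕ) :
    harmonicFactor 2 (k + 1) =
      2 * Hnum (6 * (k + 1) - 1) - Hnum (3 * (k + 1) - 1) - Hnum k := by
  have h := two_mul_oddHarmonic_succ (3 * k + 2)
  rw [harmonicFactor, two_mul_oddHarmonic_succ, show 3 * (k + 1) = 3 * k + 2 + 1 by ring,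
    show 6 * (k + 1) - 1 = 2 * (3 * k + 2) + 1 by lia, show 2 * (k + 1) - 1 = 2 * k + 1 by lia,
    Nat.add_sub_cancel]
  linear_combination h

/-! ### Integration by parts against logarithms -/

theorem log_one_sub_sq {y : ℝ} (hy : y ∈ Ioo (0 : ℝ) 1) :
    log (1 - y ^ 2) = log (1 - y) + log (1 + y) := by
  rw [← log_mul (by linarith [hy.2]) (by linarith [hy.1])]
  congr 1
  ring

theorem intervalIntegrable_log_one_sub_sq :
    IntervalIntegrable (fun y : ℝ => log (1 - y ^ 2)) volume 0 1 := by
  have hsub : IntervalIntegrable (fun y : ℝ => log (1 - y)) volume 0 1 := by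
    simpa using (intervalIntegral.intervalIntegrable_log' (a := 1) (b := 0)).comp_sub_left 1
  have hadd : IntervalIntegrable (fun y : ℝ => log (1 + y)) volume 0 1 :=
    ContinuousOn.intervalIntegrable <| by
      rw [uIcc_of_le zero_le_one]
      exact ContinuousOn.log (by fun_prop) fun y hy => by linarith [hy.1]
  refine (hsub.add hadd).congr_uIoo fun y hy => ?_
  rw [uIoo_of_le zero_le_one] at hy
  exact (log_one_sub_sq hy).symm

theorem integral_deriv_mul_log {Q Q' N : ℝ → ℝ} (hQ' : ContinuousOn Q' (Icc 0 1))
    (hN : ContinuousOn N (Icc 0 1)) (hderiv : ∀ y ∈ Ioo (0 : ℝ) 1, HasDerivAt Q (Q' y) y)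
    (hQN : ∀ y ∈ Icc (0 : ℝ) 1, Q y = y * N y) :
    ∫ y in (0 : ℝ)..1, Q' y * log y = -∫ y in (0 : ℝ)..1, N y := by
  have hQlog : ContinuousOn (fun y => Q y * log y) (Icc 0 1) :=
    (hN.mul continuous_mul_log.continuousOn).congr fun y hy => by
      rw [hQN y hy, mul_comm y, mul_assoc]; rfl
  have hint : IntervalIntegrable (fun y => Q' y * log y) volume 0 1 :=
    intervalIntegral.intervalIntegrable_log'.continuousOn_mul (by rwa [uIcc_of_le zero_le_one])
  have hintN : IntervalIntegrable N volume 0 1 := hN.intervalIntegrable_of_Icc zero_le_one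
  have hftc := intervalIntegral.integral_eq_sub_of_hasDerivAt_of_le zero_le_one hQlog
    (f' := fun y => Q' y * log y + N y) (fun y hy => by
      refine ((hderiv y hy).mul (hasDerivAt_log hy.1.ne')).congr_deriv ?_
      rw [hQN y (Ioo_subset_Icc_self hy), mul_comm y, mul_inv_cancel_right₀ hy.1.ne'])
    (hint.add hintN)
  rw [intervalIntegral.integral_add hint hintN] at hftc
  simp only [log_one, log_zero, mul_zero, sub_self] at hftc
  linarith

theorem integral_deriv_mul_log_one_sub_sq {Q Q' M : ℝ → ℝ} (hQ : ContinuousOn Q (Icc 0 1))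
    (hQ' : ContinuousOn Q' (Icc 0 1)) (hM : ContinuousOn M (Icc 0 1))
    (hderiv : ∀ y ∈ Ioo (0 : ℝ) 1, HasDerivAt Q (Q' y) y)
    (hQM : ∀ y ∈ Icc (0 : ℝ) 1, y * Q y - Q 1 = (1 - y ^ 2) * M y) :
    ∫ y in (0 : ℝ)..1, Q' y * log (1 - y ^ 2) =
      2 * log 2 * Q 1 + 2 * ∫ y in (0 : ℝ)..1, M y := by
  -- The two halves of the logarithm get different constants of integration, so that `Q y - Q 1`
  -- cancels the singularity at `1` and the boundary term at `0` vanishes.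
  set F : ℝ → ℝ := fun y => (Q y - Q 1) * log (1 - y) + (Q y + Q 1) * log (1 + y)
  have hF : ContinuousOn F (Icc 0 1) := by
    have hsub : ContinuousOn (fun y => (Q y + (1 + y) * M y) * ((1 - y) * log (1 - y)))
        (Icc 0 1) :=
      (hQ.add (ContinuousOn.mul (by fun_prop) hM)).mul
        (continuous_mul_log.comp (by fun_prop : Continuous fun y : ℝ => 1 - y)).continuousOn
    have hadd : ContinuousOn (fun y => (Q y + Q 1) * log (1 + y)) (Icc 0 1) :=
      (hQ.add continuousOn_const).mul
        (ContinuousOn.log (by fun_prop) fun y hy => by linarith [hy.1])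
    refine (hsub.add hadd).congr fun y hy => ?_
    simp only [F, Pi.add_apply]
    linear_combination log (1 - y) * hQM y hy
  have hF' (y) (hy : y ∈ Ioo (0 : ℝ) 1) : HasDerivAt F (Q' y * log (1 - y ^ 2) - 2 * M y) y := by
    have hsub : 1 - y ≠ 0 := by linarith [hy.2]
    have hadd : 1 + y ≠ 0 := by linarith [hy.1]
    have h := (((hderiv y hy).sub_const (Q 1)).mul (((hasDerivAt_id' y).const_sub 1).log hsub)).add
      (((hderiv y hy).add_const (Q 1)).mul (((hasDerivAt_id' y).const_add 1).log hadd))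
    refine h.congr_deriv ?_
    rw [log_one_sub_sq hy]
    field_simp
    linear_combination -2 * hQM y (Ioo_subset_Icc_self hy)
  have hint : IntervalIntegrable (fun y => Q' y * log (1 - y ^ 2)) volume 0 1 :=
    intervalIntegrable_log_one_sub_sq.continuousOn_mul (by rwa [uIcc_of_le zero_le_one])
  have hintM := (hM.intervalIntegrable_of_Icc zero_le_one (μ := volume)).const_mul 2
  have hftc := intervalIntegral.integral_eq_sub_of_hasDerivAt_of_le zero_le_one hF hF'
    (hint.sub hintM)
  rw [intervalIntegral.integral_sub hint hintM, intervalIntegral.integral_const_mul] at hftc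
  norm_num [F] at hftc
  linarith

/-- The function `2c log 2 + 2 log y - c log (1 - y²)`. Its integral against the integrand
`weightKernel` of the `k`-th weight brings out `harmonicFactor c`. -/
noncomputable def logFactor (c y : ℝ) : ℝ := 2 * c * log 2 + 2 * log y - c * log (1 - y ^ 2)

theorem intervalIntegrable_logFactor (c : ℝ) : IntervalIntegrable (logFactor c) volume 0 1 :=
  (intervalIntegrable_const.add (intervalIntegral.intervalIntegrable_log'.const_mul 2)).sub
    (intervalIntegrable_log_one_sub_sq.const_mul c)

theorem integral_mul_logFactor (c : ℝ) {f : ℝ → ℝ} (hf : ContinuousOn f (Icc 0 1)) :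
    ∫ y in (0 : ℝ)..1, f y * logFactor c y =
      2 * c * log 2 * (∫ y in (0 : ℝ)..1, f y) + 2 * (∫ y in (0 : ℝ)..1, f y * log y) -
        c * ∫ y in (0 : ℝ)..1, f y * log (1 - y ^ 2) := by
  have hf' : ContinuousOn f (uIcc 0 1) := by rwa [uIcc_of_le zero_le_one]
  have hint := (hf.intervalIntegrable_of_Icc zero_le_one (μ := volume)).const_mul (2 * c * log 2)
  have hlog := (intervalIntegral.intervalIntegrable_log'.continuousOn_mul hf').const_mul 2
  have hsub := (intervalIntegrable_log_one_sub_sq.continuousOn_mul hf').const_mul c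
  simp only [← intervalIntegral.integral_const_mul]
  rw [← intervalIntegral.integral_add hint hlog,
    ← intervalIntegral.integral_sub (hint.add hlog) hsub]
  congr 1 with y
  rw [logFactor]
  ring

theorem integral_deriv_mul_logFactor (c : ℝ) {Q Q' N M : ℝ → ℝ} (hQ' : ContinuousOn Q' (Icc 0 1))
    (hN : ContinuousOn N (Icc 0 1)) (hM : ContinuousOn M (Icc 0 1))
    (hderiv : ∀ y ∈ Ioo (0 : ℝ) 1, HasDerivAt Q (Q' y) y)
    (hQN : ∀ y ∈ Icc (0 : ℝ) 1, Q y = y * N y)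
    (hQM : ∀ y ∈ Icc (0 : ℝ) 1, y * Q y - Q 1 = (1 - y ^ 2) * M y) :
    ∫ y in (0 : ℝ)..1, Q' y * logFactor c y = -2 * ∫ y in (0 : ℝ)..1, (N y + c * M y) := by
  have hQ : ContinuousOn Q (Icc 0 1) := (continuousOn_id.mul hN).congr hQN
  have hftc := intervalIntegral.integral_eq_sub_of_hasDerivAt_of_le zero_le_one hQ hderiv
    (hQ'.intervalIntegrable_of_Icc zero_le_one)
  rw [integral_mul_logFactor c hQ', integral_deriv_mul_log hQ' hN hderiv hQN,
    integral_deriv_mul_log_one_sub_sq hQ hQ' hM hderiv hQM, hftc, hQN 0 (by simp),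
    intervalIntegral.integral_add (hN.intervalIntegrable_of_Icc zero_le_one)
      ((hM.intervalIntegrable_of_Icc zero_le_one).const_mul c),
    intervalIntegral.integral_const_mul]
  ring

theorem integral_pow_mul_log (n : ℕ) :
    ∫ y in (0 : ℝ)..1, y ^ n * log y = -1 / ((n : ℝ) + 1) ^ 2 := by
  have hn : (n : ℝ) + 1 ≠ 0 := by positivity
  rw [integral_deriv_mul_log (Q := fun y => y ^ (n + 1) / (n + 1)) (N := fun y => y ^ n / (n + 1))
    (by fun_prop) (by fun_prop)]
  · rw [intervalIntegral.integral_div, integral_pow, one_pow, zero_pow n.succ_ne_zero]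
    field_simp
    ring
  · intro y _
    refine ((hasDerivAt_pow (n + 1) y).div_const _).congr_deriv ?_
    push_cast
    rw [mul_div_cancel_left₀ _ hn]
  · intro y _
    ring

/-! ### The weights as beta integrals -/

/-- The closed form of `∫₀¹ y ^ (2n) (1 - y²) ^ m dy`. -/
noncomputable def evenBeta (m n : ℕ) : ℝ :=
  (m.factorial * 2 ^ (2 * m + 1) * (n + m + 1).factorial * (2 * n).factorial : ℝ) /
    ((2 * (n + m + 1)).factorial * n.factorial)

theorem factorial_two_mul_succ (n : ℕ) :
    (2 * (n + 1)).factorial = (2 * n + 2) * ((2 * n + 1) * (2 * n).factorial) := by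
  rw [show 2 * (n + 1) = 2 * n + 1 + 1 by ring, Nat.factorial_succ, Nat.factorial_succ]

theorem evenBeta_zero_left (n : ℕ) : evenBeta 0 n = 1 / (2 * (n : ℝ) + 1) := by
  rw [evenBeta, add_zero, factorial_two_mul_succ, Nat.factorial_succ, Nat.factorial_zero]
  push_cast
  field_simp

theorem evenBeta_succ_right (m n : ℕ) :
    evenBeta m (n + 1) = evenBeta m n * ((2 * n + 1) / (2 * (n + m) + 3)) := by
  rw [evenBeta, evenBeta, show n + 1 + m + 1 = (n + m + 1) + 1 by ring,
    factorial_two_mul_succ (n + m + 1), factorial_two_mul_succ n, Nat.factorial_succ (n + m + 1),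
    Nat.factorial_succ n]
  push_cast
  rw [show 2 * ((n : ℝ) + m + 1) + 1 = 2 * (n + m) + 3 by ring]
  field_simp

theorem evenBeta_succ_left (m n : ℕ) :
    evenBeta (m + 1) n = evenBeta m n * (2 * (m + 1) / (2 * (n + m) + 3)) := by
  rw [evenBeta, evenBeta, show n + (m + 1) + 1 = (n + m + 1) + 1 by ring,
    factorial_two_mul_succ (n + m + 1), Nat.factorial_succ (n + m + 1), Nat.factorial_succ m]
  push_cast
  rw [show 2 * ((n : ℝ) + m + 1) + 1 = 2 * (n + m) + 3 by ring,
    show 2 * (m + 1) + 1 = 2 * m + 1 + 1 + 1 by ring, pow_succ, pow_succ]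
  field_simp

theorem integral_moment_succ {g : ℝ → ℝ} (hg : IntervalIntegrable g volume 0 1) (m n : ℕ) :
    ∫ y in (0 : ℝ)..1, y ^ (2 * n) * (1 - y ^ 2) ^ (m + 1) * g y =
      (∫ y in (0 : ℝ)..1, y ^ (2 * n) * (1 - y ^ 2) ^ m * g y) -
        ∫ y in (0 : ℝ)..1, y ^ (2 * (n + 1)) * (1 - y ^ 2) ^ m * g y := by
  rw [← intervalIntegral.integral_sub (hg.continuousOn_mul (by fun_prop))
    (hg.continuousOn_mul (by fun_prop))]
  congr 1 with y
  ring

theorem integral_moment (m n : ℕ) :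
    ∫ y in (0 : ℝ)..1, y ^ (2 * n) * (1 - y ^ 2) ^ m = evenBeta m n := by
  induction m generalizing n with
  | zero => simp [evenBeta_zero_left]
  | succ m ih =>
    have h := integral_moment_succ (g := fun _ => 1) intervalIntegrable_const m n
    simp only [mul_one] at h
    rw [h, ih, ih, evenBeta_succ_right, evenBeta_succ_left]
    field_simp
    ring

theorem integral_even_pow_mul_logFactor (c : ℝ) (n : ℕ) :
    ∫ y in (0 : ℝ)..1, y ^ (2 * n) * logFactor c y =
      (2 * c * oddHarmonic (n + 1) - 2 / (2 * n + 1)) / (2 * n + 1) := by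
  have hn : 2 * (n : ℝ) + 1 ≠ 0 := by positivity
  rw [integral_deriv_mul_logFactor c (Q := fun y => y ^ (2 * n + 1) / (2 * n + 1))
    (N := fun y => y ^ (2 * n) / (2 * n + 1))
    (M := fun y => -(∑ j ∈ Finset.range (n + 1), y ^ (2 * j)) / (2 * n + 1))
    (by fun_prop) (by fun_prop) (by fun_prop)]
  · have hsum : ∫ y in (0 : ℝ)..1, ∑ j ∈ Finset.range (n + 1), y ^ (2 * j) =
        oddHarmonic (n + 1) := by
      rw [intervalIntegral.integral_finsetSum fun j _ => by
        apply Continuous.intervalIntegrable; fun_prop]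
      simp [oddHarmonic]
    rw [intervalIntegral.integral_add (by apply Continuous.intervalIntegrable; fun_prop)
      (by apply Continuous.intervalIntegrable; fun_prop), intervalIntegral.integral_const_mul,
      intervalIntegral.integral_div, intervalIntegral.integral_div, intervalIntegral.integral_neg,
      hsum, integral_pow]
    rw [one_pow, zero_pow (2 * n).succ_ne_zero]
    push_cast
    ring
  · intro y _
    refine ((hasDerivAt_pow (2 * n + 1) y).div_const _).congr_deriv ?_
    push_cast
    rw [mul_div_cancel_left₀ _ hn]
  · intro y _
    ring
  · intro y _
    have hgeom := mul_neg_geom_sum (y ^ 2) (n + 1)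
    simp only [← pow_mul] at hgeom
    rw [one_pow]
    linear_combination hgeom / (2 * (n : ℝ) + 1)

theorem integral_moment_mul_logFactor (c : ℝ) (m n : ℕ) :
    ∫ y in (0 : ℝ)..1, y ^ (2 * n) * (1 - y ^ 2) ^ m * logFactor c y =
      evenBeta m n *
        (2 * oddHarmonic n + (2 * c - 2) * oddHarmonic (n + m + 1) - c * Hnum m) := by
  induction m generalizing n with
  | zero =>
    simp only [pow_zero, mul_one, integral_even_pow_mul_logFactor, evenBeta_zero_left, add_zero,
      Hnum_zero, oddHarmonic_succ]
    ring
  | succ m ih =>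
    rw [integral_moment_succ (intervalIntegrable_logFactor c), ih, ih, evenBeta_succ_right,
      evenBeta_succ_left, show n + 1 + m + 1 = n + m + 1 + 1 by ring,
      show n + (m + 1) + 1 = n + m + 1 + 1 by ring, oddHarmonic_succ (n + m + 1),
      oddHarmonic_succ n, Hnum_succ]
    push_cast
    rw [show 2 * ((n : ℝ) + m + 1) + 1 = 2 * (n + m) + 3 by ring]
    field_simp
    ring

theorem binomWeight_succ_div (k : ℕ) :
    binomWeight (k + 1) / ((k : ℝ) + 1) =
      4 * (1 / 2) ^ (k + 1) * evenBeta (2 * k + 1) (k + 1) := by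
  rw [binomWeight, evenBeta, Nat.cast_choose ℝ (by lia : k + 1 ≤ 2 * (k + 1)),
    Nat.cast_choose ℝ (by lia : k + 1 ≤ 3 * (k + 1)),
    Nat.cast_choose ℝ (by lia : 3 * (k + 1) ≤ 6 * (k + 1)),
    show 2 * (k + 1) - (k + 1) = k + 1 by lia, show 3 * (k + 1) - (k + 1) = 2 * (k + 1) by lia,
    show 6 * (k + 1) - 3 * (k + 1) = 3 * (k + 1) by lia,
    show k + 1 + (2 * k + 1) + 1 = 3 * (k + 1) by ring,
    show 2 * (3 * (k + 1)) = 6 * (k + 1) by ring]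
  have hfactorial : ((2 * (k + 1)).factorial : ℝ) = 2 * ((k : ℝ) + 1) * (2 * k + 1).factorial := by
    rw [show 2 * (k + 1) = 2 * k + 1 + 1 by ring, Nat.factorial_succ]
    push_cast
    ring
  have hpow : (8 : ℝ) ^ (k + 1) = 4 * 2 ^ (2 * (2 * k + 1) + 1) * (1 / 2) ^ (k + 1) / 2 := by
    rw [show (8 : ℝ) = 2 ^ 4 * (1 / 2) by norm_num, mul_pow, ← pow_mul]
    ring
  rw [hpow, hfactorial]
  field_simp

/-- The ratio of the geometric progression `weightKernel · y`. -/
noncomputable def kernelRatio (y : ℝ) : ℝ := y ^ 2 * (1 - y ^ 2) ^ 2 / 2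

/-- The beta integrand `4 · 2 ^ (-k - 1) y ^ (2k + 2) (1 - y²) ^ (2k + 1)` representing
`binomWeight (k + 1) / (k + 1)`; the index is shifted so that the series start at `0`. -/
noncomputable def weightKernel (k : ℕ) (y : ℝ) : ℝ :=
  2 * (y ^ 2 * (1 - y ^ 2)) * kernelRatio y ^ k

theorem continuous_weightKernel (k : ℕ) : Continuous (weightKernel k) := by
  unfold weightKernel kernelRatio
  fun_prop

theorem weightKernel_eq (k : ℕ) (y : ℝ) :
    weightKernel k y = 4 * (1 / 2) ^ (k + 1) * (y ^ (2 * (k + 1)) * (1 - y ^ 2) ^ (2 * k + 1)) := by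
  rw [weightKernel, kernelRatio, div_pow, mul_pow (y ^ 2), ← pow_mul, ← pow_mul, one_div, inv_pow,
    pow_succ (2 : ℝ)]
  field_simp
  ring

theorem integral_weightKernel (k : ℕ) :
    ∫ y in (0 : ℝ)..1, weightKernel k y = binomWeight (k + 1) / ((k : ℝ) + 1) := by
  simp only [weightKernel_eq]
  rw [intervalIntegral.integral_const_mul, integral_moment, binomWeight_succ_div]

theorem integral_weightKernel_mul_logFactor (c : ℝ) (k : ℕ) :
    ∫ y in (0 : ℝ)..1, weightKernel k y * logFactor c y =
      binomWeight (k + 1) / ((k : ℝ) + 1) * harmonicFactor c (k + 1) := by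
  simp only [weightKernel_eq, mul_assoc (4 * (1 / 2 : ℝ) ^ (k + 1))]
  rw [intervalIntegral.integral_const_mul, integral_moment_mul_logFactor, binomWeight_succ_div,
    harmonicFactor, show k + 1 + (2 * k + 1) + 1 = 3 * (k + 1) by ring,
    show 2 * (k + 1) - 1 = 2 * k + 1 by lia]
  ring

/-! ### Summation under the integral sign -/

theorem one_add_pow_four_pos (y : ℝ) : 0 < 1 + y ^ 4 := by positivity

theorem two_sub_sq_pos {y : ℝ} (hy : y ∈ Icc (0 : ℝ) 1) : 0 < 2 - y ^ 2 := by
  linarith [pow_le_one₀ (n := 2) hy.1 hy.2]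

/-- The polynomial `2 - y² (1 - y²)²`, in factored form: the common denominator of the sums of the
series under the integral sign. -/
noncomputable def sexticDenom (y : ℝ) : ℝ := (2 - y ^ 2) * (1 + y ^ 4)

theorem sexticDenom_pos {y : ℝ} (hy : y ∈ Icc (0 : ℝ) 1) : 0 < sexticDenom y :=
  mul_pos (two_sub_sq_pos hy) (one_add_pow_four_pos y)

theorem continuous_sexticDenom : Continuous sexticDenom := by
  unfold sexticDenom
  fun_prop

theorem continuousOn_div_sexticDenom_pow {f : ℝ → ℝ} (hf : Continuous f) (e : ℕ) :
    ContinuousOn (fun y => f y / sexticDenom y ^ e) (Icc 0 1) :=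
  hf.continuousOn.div (continuous_sexticDenom.pow e).continuousOn
    fun _ hy => pow_ne_zero e (sexticDenom_pos hy).ne'

theorem one_sub_kernelRatio (y : ℝ) : 1 - kernelRatio y = sexticDenom y / 2 := by
  rw [kernelRatio, sexticDenom]
  ring

theorem kernelRatio_nonneg (y : ℝ) : 0 ≤ kernelRatio y := by
  unfold kernelRatio
  positivity

theorem kernelRatio_le_half {y : ℝ} (hy : y ∈ Icc (0 : ℝ) 1) : kernelRatio y ≤ 1 / 2 := by
  have hsq : y ^ 2 ≤ 1 := pow_le_one₀ hy.1 hy.2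
  have hmul : y ^ 2 * (1 - y ^ 2) ^ 2 ≤ 1 :=
    mul_le_one₀ hsq (sq_nonneg _) (pow_le_one₀ (by linarith) (by linarith [sq_nonneg y]))
  rw [kernelRatio]
  linarith

theorem abs_weightKernel_le (k : ℕ) {y : ℝ} (hy : y ∈ Icc (0 : ℝ) 1) :
    |weightKernel k y| ≤ 2 * (1 / 2) ^ k := by
  have hsq : y ^ 2 ≤ 1 := pow_le_one₀ hy.1 hy.2
  have hpos : 0 ≤ y ^ 2 * (1 - y ^ 2) := mul_nonneg (sq_nonneg y) (by linarith)
  have hle : y ^ 2 * (1 - y ^ 2) ≤ 1 := by nlinarith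
  have hratio := kernelRatio_nonneg y
  rw [weightKernel,
    abs_of_nonneg (mul_nonneg (mul_nonneg zero_le_two hpos) (pow_nonneg hratio k))]
  gcongr
  · linarith
  · exact kernelRatio_le_half hy

/-- Quadratic polynomials in `k`, expanded in the binomial coefficients `C(k + j, j)` so that their
generating functions are immediate. -/
noncomputable def quadCoeff (a b c : ℝ) (k : ℕ) : ℝ :=
  a + b * ((k : ℝ) + 1) + c * (((k : ℝ) + 1) * (k + 2) / 2)

theorem hasSum_quadCoeff_mul_pow (a b c : ℝ) {z : ℝ} (hz : ‖z‖ < 1) :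
    HasSum (fun k => quadCoeff a b c k * z ^ k)
      (a / (1 - z) + b / (1 - z) ^ 2 + c / (1 - z) ^ 3) := by
  convert (((hasSum_choose_mul_geometric_of_norm_lt_one 0 hz).mul_left a).add
    ((hasSum_choose_mul_geometric_of_norm_lt_one 1 hz).mul_left b)).add
    ((hasSum_choose_mul_geometric_of_norm_lt_one 2 hz).mul_left c) using 1
  · rfl
  · ext k
    rw [quadCoeff, Nat.cast_choose_two]
    simp only [Nat.choose_zero_right, Nat.choose_one_right]
    push_cast
    ring
  · ring

/-- The sum over `k` of `quadCoeff a b c k * weightKernel k y`. -/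
noncomputable def sumKernel (a b c y : ℝ) : ℝ :=
  2 * (y ^ 2 * (1 - y ^ 2)) *
    (2 * a / sexticDenom y + 4 * b / sexticDenom y ^ 2 + 8 * c / sexticDenom y ^ 3)

theorem continuousOn_sumKernel (a b c : ℝ) : ContinuousOn (sumKernel a b c) (Icc 0 1) := by
  have h (r : ℝ) := continuousOn_div_sexticDenom_pow (continuous_const (y := r))
  have h₁ := h (2 * a) 1
  simp only [pow_one] at h₁
  exact ContinuousOn.mul (by fun_prop) ((h₁.add (h (4 * b) 2)).add (h (8 * c) 3))

theorem hasSum_quadCoeff_mul_weightKernel (a b c : ℝ) {y : ℝ} (hy : y ∈ Icc (0 : ℝ) 1) :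
    HasSum (fun k => quadCoeff a b c k * weightKernel k y) (sumKernel a b c y) := by
  have hratio : ‖kernelRatio y‖ < 1 := by
    rw [norm_of_nonneg (kernelRatio_nonneg y)]
    linarith [kernelRatio_le_half hy]
  have hdenom := (sexticDenom_pos hy).ne'
  convert (hasSum_quadCoeff_mul_pow a b c hratio).mul_left (2 * (y ^ 2 * (1 - y ^ 2))) using 1
  · rfl
  · ext k
    rw [weightKernel]
    ring
  · rw [sumKernel, one_sub_kernelRatio]
    field_simp
    ring

theorem hasSum_quadCoeff_mul_integral_weightKernel (a b c : ℝ) {g : ℝ → ℝ}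
    (hg : IntervalIntegrable g volume 0 1) :
    HasSum (fun k => quadCoeff a b c k * ∫ y in (0 : ℝ)..1, weightKernel k y * g y)
      (∫ y in (0 : ℝ)..1, sumKernel a b c y * g y) := by
  have hsummable : Summable fun k => |quadCoeff a b c k| * (1 / 2) ^ k :=
    (hasSum_quadCoeff_mul_pow a b c (z := 1 / 2) (by norm_num)).summable.abs.congr fun k => by
      rw [abs_mul, abs_of_pos (by positivity : (0 : ℝ) < (1 / 2) ^ k)]
  have hIcc {y : ℝ} (hy : y ∈ uIoc (0 : ℝ) 1) : y ∈ Icc (0 : ℝ) 1 := by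
    rw [uIoc_of_le zero_le_one] at hy
    exact Ioc_subset_Icc_self hy
  have h := intervalIntegral.hasSum_integral_of_dominated_convergence (μ := volume)
    (F := fun k y => quadCoeff a b c k * (weightKernel k y * g y))
    (f := fun y => sumKernel a b c y * g y)
    (fun k y => |quadCoeff a b c k| * (1 / 2) ^ k * (2 * |g y|)) (a := 0) (b := 1)
    (fun k => (intervalIntegrable_iff.mp ((hg.continuousOn_mul
      (continuous_weightKernel k).continuousOn).const_mul _)).aestronglyMeasurable)
    (fun k => .of_forall fun y hy => ?_) (.of_forall fun y _ => hsummable.mul_right _) ?_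
    (.of_forall fun y hy => ?_)
  · simpa only [intervalIntegral.integral_const_mul] using h
  · rw [norm_mul, norm_mul, norm_eq_abs, norm_eq_abs, norm_eq_abs]
    calc |quadCoeff a b c k| * (|weightKernel k y| * |g y|)
        ≤ |quadCoeff a b c k| * (2 * (1 / 2) ^ k * |g y|) := by
          gcongr
          exact abs_weightKernel_le k (hIcc hy)
      _ = |quadCoeff a b c k| * (1 / 2) ^ k * (2 * |g y|) := by ring
  · simp only [tsum_mul_right]
    exact (hg.abs.const_mul 2).const_mul _
  · simpa only [mul_assoc] using
      (hasSum_quadCoeff_mul_weightKernel a b c (hIcc hy)).mul_right (g y)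

theorem hasSum_quadCoeff_mul_binomWeight (a b c : ℝ) :
    HasSum (fun k : ℕ => quadCoeff a b c k * (binomWeight (k + 1) / ((k : ℝ) + 1)))
      (∫ y in (0 : ℝ)..1, sumKernel a b c y) := by
  simpa only [mul_one, integral_weightKernel] using
    hasSum_quadCoeff_mul_integral_weightKernel a b c (g := fun _ => 1) intervalIntegrable_const

theorem hasSum_quadCoeff_mul_binomWeight_mul_harmonicFactor (a b c s : ℝ) :
    HasSum (fun k : ℕ => quadCoeff a b c k *
        (binomWeight (k + 1) / ((k : ℝ) + 1) * harmonicFactor s (k + 1)))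
      (∫ y in (0 : ℝ)..1, sumKernel a b c y * logFactor s y) := by
  simpa only [integral_weightKernel_mul_logFactor] using
    hasSum_quadCoeff_mul_integral_weightKernel a b c (intervalIntegrable_logFactor s)

/-! ### Integrals of the residual weights -/

/-- The weight `(1 + y²) / (1 + y⁴) = ∑ (-8 / (n + 1)) y ^ n`: up to the derivative of a rational
function, the kernels `sumKernel` of the series are multiples of it. -/
noncomputable def quarticWeight (y : ℝ) : ℝ := (1 + y ^ 2) / (1 + y ^ 4)

theorem continuous_quarticWeight : Continuous quarticWeight :=
  Continuous.div (by fun_prop) (by fun_prop) fun y => (one_add_pow_four_pos y).ne'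

theorem image_one_sub_sq_div :
    (fun y : ℝ => (1 - y ^ 2) / (√2 * y)) '' Ioo 0 1 = Ioi 0 := by
  refine Subset.antisymm ?_ fun v (hv : 0 < v) => ?_
  · rintro _ ⟨y, ⟨hy₀, hy₁⟩, rfl⟩
    exact div_pos (sub_pos.mpr (pow_lt_one₀ hy₀.le hy₁ two_ne_zero))
      (mul_pos (sqrt_pos.mpr two_pos) hy₀)
  · have hsq : √(v ^ 2 + 2) ^ 2 = v ^ 2 + 2 := sq_sqrt (by positivity)
    have htwo : √2 ^ 2 = (2 : ℝ) := sq_sqrt zero_le_two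
    have hpos : 0 < √2 := by positivity
    have hlt : v < √(v ^ 2 + 2) := lt_sqrt_of_sq_lt (by linarith)
    have hle : √(v ^ 2 + 2) < v + √2 :=
      (sqrt_lt' (by positivity)).mpr (by nlinarith [mul_pos hv hpos])
    refine ⟨(√(v ^ 2 + 2) - v) / √2, ⟨div_pos (by linarith) hpos,
      (div_lt_one hpos).mpr (by linarith)⟩, ?_⟩
    simp only
    rw [div_pow, htwo, mul_div_cancel₀ _ hpos.ne', div_eq_iff (by linarith)]
    linear_combination (-1 / 2 : ℝ) * hsq

theorem integral_quarticWeight_mul_comp (f : ℝ → ℝ) :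
    ∫ y in (0 : ℝ)..1, quarticWeight y * f ((1 - y ^ 2) / (√2 * y)) =
      (√2)⁻¹ * ∫ v in Ioi (0 : ℝ), (1 + v ^ 2)⁻¹ * f v := by
  have htwo : √2 ^ 2 = (2 : ℝ) := sq_sqrt zero_le_two
  have hderiv : ∀ y ∈ Ioo (0 : ℝ) 1, HasDerivWithinAt (fun y => (1 - y ^ 2) / (√2 * y))
      (-((1 + y ^ 2) / (√2 * y ^ 2))) (Ioo 0 1) y := fun y hy => by
    have hy₀ : 0 < y := hy.1
    refine ((((hasDerivAt_pow 2 y).const_sub 1).div ((hasDerivAt_id' y).const_mul √2)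
      (by positivity)).congr_deriv ?_).hasDerivWithinAt
    field_simp
    ring
  have hanti : AntitoneOn (fun y : ℝ => (1 - y ^ 2) / (√2 * y)) (Ioo 0 1) :=
    fun a ha b _ hab => by
      have ha₀ : 0 < a := ha.1
      have ha₁ : a ^ 2 ≤ 1 := pow_le_one₀ ha₀.le ha.2.le
      dsimp only
      gcongr
  rw [← image_one_sub_sq_div, integral_image_eq_integral_deriv_smul_of_antitoneOn
    measurableSet_Ioo hderiv hanti, intervalIntegral.integral_of_le zero_le_one,
    integral_Ioc_eq_integral_Ioo, ← integral_const_mul]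
  refine setIntegral_congr_fun measurableSet_Ioo fun y ⟨hy₀, _⟩ => ?_
  have hv : 1 + ((1 - y ^ 2) / (√2 * y)) ^ 2 = (1 + y ^ 4) / (2 * y ^ 2) := by
    rw [div_pow, mul_pow, htwo]
    field_simp
    ring
  have hpos := (one_add_pow_four_pos y).ne'
  simp only [smul_eq_mul, neg_neg, quarticWeight]
  rw [hv]
  field_simp
  rw [htwo, mul_comm]

theorem integral_quarticWeight : ∫ y in (0 : ℝ)..1, quarticWeight y = π / (2 * √2) := by
  have h := integral_quarticWeight_mul_comp fun _ => 1
  simp only [mul_one, integral_Ioi_inv_one_add_sq, arctan_zero, sub_zero] at h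
  rw [h]
  field_simp

theorem integral_Ioi_inv_one_add_sq_mul_log :
    ∫ v in Ioi (0 : ℝ), (1 + v ^ 2)⁻¹ * log v = 0 := by
  suffices h : ∫ v in Ioi (0 : ℝ), (1 + v ^ 2)⁻¹ * log v =
      -∫ v in Ioi (0 : ℝ), (1 + v ^ 2)⁻¹ * log v by linarith
  rw [← integral_neg, ← integral_comp_rpow_Ioi _ (show (-1 : ℝ) ≠ 0 by norm_num)]
  refine setIntegral_congr_fun measurableSet_Ioi fun v (hv : 0 < v) => ?_
  have hpow : v ^ (-1 - 1 : ℝ) = (v ^ 2)⁻¹ := by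
    rw [show (-1 - 1 : ℝ) = -(2 : ℕ) by norm_num, rpow_neg hv.le, rpow_natCast]
  simp only [smul_eq_mul, hpow, rpow_neg_one, log_inv, abs_neg, abs_one]
  field_simp
  ring

theorem integral_quarticWeight_mul_log_one_sub_sq :
    ∫ y in (0 : ℝ)..1, quarticWeight y * log (1 - y ^ 2) =
      (∫ y in (0 : ℝ)..1, quarticWeight y * log y) + log 2 / 2 * (π / (2 * √2)) := by
  have hsub := intervalIntegrable_log_one_sub_sq.continuousOn_mul
    continuous_quarticWeight.continuousOn
  have hlog := (intervalIntegral.intervalIntegrable_log' (a := 0) (b := 1)).continuousOn_mul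
    continuous_quarticWeight.continuousOn
  have hconst :=
    (continuous_quarticWeight.intervalIntegrable (μ := volume) 0 1).const_mul (log 2 / 2)
  have hsubst : ∫ y in (0 : ℝ)..1, quarticWeight y * log ((1 - y ^ 2) / (√2 * y)) = 0 := by
    rw [integral_quarticWeight_mul_comp log, integral_Ioi_inv_one_add_sq_mul_log, mul_zero]
  have hsplit : ∫ y in (0 : ℝ)..1, quarticWeight y * log ((1 - y ^ 2) / (√2 * y)) =
      ∫ y in (0 : ℝ)..1, (quarticWeight y * log (1 - y ^ 2) - quarticWeight y * log y -
        log 2 / 2 * quarticWeight y) := by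
    refine intervalIntegral.integral_congr_uIoo fun y hy => ?_
    rw [uIoo_of_le zero_le_one] at hy
    have hy₀ : 0 < y := hy.1
    have hy₁ : 1 - y ^ 2 ≠ 0 := by nlinarith [hy.2]
    rw [log_div hy₁ (by positivity), log_mul (by positivity) hy₀.ne', log_sqrt zero_le_two]
    ring
  rw [hsubst, intervalIntegral.integral_sub (hsub.sub hlog) hconst,
    intervalIntegral.integral_sub hsub hlog, intervalIntegral.integral_const_mul,
    integral_quarticWeight] at hsplit
  linarith

theorem hasSum_div_sq_of_hasSum_mul_pow {a : ℕ → ℝ} {f : ℝ → ℝ} {C : ℝ} (ha : ∀ n, |a n| ≤ C)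
    (hf : ∀ y ∈ Ioo (0 : ℝ) 1, HasSum (fun n => a n * y ^ n) (f y)) :
    HasSum (fun n : ℕ => a n / ((n : ℝ) + 1) ^ 2) (-∫ y in (0 : ℝ)..1, f y * log y) := by
  have hint (n : ℕ) : IntegrableOn (fun y => a n * (y ^ n * -log y)) (Ioo 0 1) :=
    (intervalIntegrable_iff_integrableOn_Ioo_of_le zero_le_one).mp
      (((intervalIntegral.intervalIntegrable_log' (a := 0) (b := 1)).neg.continuousOn_mul
        (by fun_prop)).const_mul _)
  have hterm (b : ℝ) (n : ℕ) :
      ∫ y in Ioo (0 : ℝ) 1, b * (y ^ n * -log y) = b / ((n : ℝ) + 1) ^ 2 := by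
    rw [← integral_Ioc_eq_integral_Ioo, ← intervalIntegral.integral_of_le zero_le_one,
      intervalIntegral.integral_const_mul]
    simp only [mul_neg, intervalIntegral.integral_neg, integral_pow_mul_log]
    ring
  have hnorm (n : ℕ) : ∫ y in Ioo (0 : ℝ) 1, ‖a n * (y ^ n * -log y)‖ =
      |a n| / ((n : ℝ) + 1) ^ 2 := by
    rw [← hterm]
    refine setIntegral_congr_fun measurableSet_Ioo fun y hy => ?_
    rw [norm_mul, norm_eq_abs, norm_of_nonneg (mul_nonneg (pow_nonneg hy.1.le n)
      (neg_nonneg.mpr (log_nonpos hy.1.le hy.2.le)))]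
  have hsummable : Summable fun n : ℕ => ∫ y in Ioo (0 : ℝ) 1, ‖a n * (y ^ n * -log y)‖ := by
    have hsq : Summable fun n : ℕ => C * (1 / ((n : ℝ) + 1) ^ 2) := by
      simpa using ((summable_nat_add_iff 1).mpr
        (summable_one_div_nat_pow.mpr one_lt_two)).mul_left C
    refine hsq.of_nonneg_of_le (fun n => by positivity) fun n => ?_
    rw [hnorm, mul_one_div]
    gcongr
    exact ha n
  have h := hasSum_integral_of_summable_integral_norm hint hsummable
  simp only [hterm] at h
  convert h using 1
  · rfl
  rw [intervalIntegral.integral_of_le zero_le_one, integral_Ioc_eq_integral_Ioo, ← integral_neg]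
  refine setIntegral_congr_fun measurableSet_Ioo fun y hy => ?_
  simpa only [mul_assoc, mul_neg] using (((hf y hy).mul_right (-log y)).tsum_eq).symm

theorem abs_χ₈'_le_one (a : ZMod 8) : |(ZMod.χ₈' a : ℝ)| ≤ 1 := by
  have h : ∀ a : ZMod 8, |ZMod.χ₈' a| ≤ 1 := by decide
  exact_mod_cast h a

theorem hasSum_χ₈'_mul_pow {y : ℝ} (hy : |y| < 1) :
    HasSum (fun n : ℕ => (ZMod.χ₈' ((n + 1 : ℕ) : ZMod 8) : ℝ) * y ^ n) (quarticWeight y) := by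
  set f : ℕ → ℝ := fun n => (ZMod.χ₈' ((n + 1 : ℕ) : ZMod 8) : ℝ) * y ^ n
  have hf : Summable f := by
    refine .of_norm_bounded (summable_geometric_of_lt_one (abs_nonneg y) hy) fun n => ?_
    rw [norm_mul, norm_pow, norm_eq_abs, norm_eq_abs]
    exact mul_le_of_le_one_left (by positivity) (abs_χ₈'_le_one _)
  have hshift (n : ℕ) : f (n + 4) = -y ^ 4 * f n := by
    have hχ : ∀ a : ZMod 8, ZMod.χ₈' (a + 4) = -ZMod.χ₈' a := by decide
    simp only [f, show n + 4 + 1 = n + 1 + 4 by ring]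
    rw [Nat.cast_add (n + 1), Nat.cast_ofNat, hχ]
    push_cast
    ring
  have hinit : ∑ n ∈ Finset.range 4, f n = 1 + y ^ 2 := by
    have hχ : ZMod.χ₈' (1 : ℕ) = 1 ∧ ZMod.χ₈' (2 : ℕ) = 0 ∧ ZMod.χ₈' (3 : ℕ) = 1 ∧
      ZMod.χ₈' (4 : ℕ) = 0 := by decide
    simp only [Finset.sum_range_succ, Finset.sum_range_zero, f, Nat.reduceAdd, hχ]
    push_cast
    ring
  have hrec := hf.sum_add_tsum_nat_add 4
  simp only [hshift, tsum_mul_left, hinit] at hrec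
  convert hf.hasSum using 1
  rw [quarticWeight, div_eq_iff (one_add_pow_four_pos y).ne']
  linear_combination hrec

theorem hasSum_pnat_of_succ {f : ℕ+ → ℝ} {a : ℝ} (hf : HasSum (fun k : ℕ => f k.succPNat) a) :
    HasSum f a :=
  Equiv.pnatEquivNat.symm.hasSum_iff.mp hf

theorem integral_quarticWeight_mul_log :
    ∫ y in (0 : ℝ)..1, quarticWeight y * log y = -LTwoNegEight := by
  have h := hasSum_div_sq_of_hasSum_mul_pow (fun n => abs_χ₈'_le_one (n + 1 : ℕ))
    fun y hy => hasSum_χ₈'_mul_pow (abs_lt.mpr ⟨by linarith [hy.1], hy.2⟩)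
  have hL : HasSum (fun n : ℕ+ => (kroneckerSymbol (-8) n : ℝ) / ((n : ℕ) : ℝ) ^ 2)
      (-∫ y in (0 : ℝ)..1, quarticWeight y * log y) :=
    hasSum_pnat_of_succ <| by simpa [kroneckerSymbol_neg_eight] using h
  rw [LTwoNegEight, hL.tsum_eq, neg_neg]

theorem integral_quarticWeight_mul_logFactor (c : ℝ) :
    ∫ y in (0 : ℝ)..1, quarticWeight y * logFactor c y =
      3 / 2 * c * log 2 * (π / (2 * √2)) - (2 - c) * LTwoNegEight := by
  rw [integral_mul_logFactor c continuous_quarticWeight.continuousOn, integral_quarticWeight,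
    integral_quarticWeight_mul_log_one_sub_sq, integral_quarticWeight_mul_log]
  ring

/-- The function `(1 - y²) / (1 + y⁴) - 1 / (2 - y²)`. It appears alongside `quarticWeight` among
the rational functions to be integrated, but its integral over `[0, 1]` vanishes. -/
noncomputable def nullWeight (y : ℝ) : ℝ := (1 - y ^ 2) / (1 + y ^ 4) - 1 / (2 - y ^ 2)

theorem integral_one_sub_sq_div_one_add_pow_four :
    ∫ y in (0 : ℝ)..1, (1 - y ^ 2) / (1 + y ^ 4) =
      (√2)⁻¹ * ∫ u in (0 : ℝ)..1 / √2, 1 / (1 - u ^ 2) := by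
  have htwo : √2 ^ 2 = (2 : ℝ) := sq_sqrt zero_le_two
  have hderiv (y : ℝ) : HasDerivAt (fun y => √2 * y / (1 + y ^ 2))
      (√2 * (1 - y ^ 2) / (1 + y ^ 2) ^ 2) y := by
    refine (((hasDerivAt_id' y).const_mul √2).div ((hasDerivAt_pow 2 y).const_add 1)
      (by positivity)).congr_deriv ?_
    push_cast
    ring
  have hsq (y : ℝ) : 1 - (√2 * y / (1 + y ^ 2)) ^ 2 = (1 + y ^ 4) / (1 + y ^ 2) ^ 2 := by
    rw [div_pow, mul_pow, htwo]
    field_simp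
    ring
  have hsubst := intervalIntegral.integral_comp_mul_deriv' (g := fun u => 1 / (1 - u ^ 2))
    (a := 0) (b := 1) (fun y _ => hderiv y)
    (Continuous.div (by fun_prop) (by fun_prop) fun y => by positivity).continuousOn
    (ContinuousOn.div (by fun_prop) (by fun_prop) (by
      rintro _ ⟨y, -, rfl⟩
      rw [hsq]
      exact (div_pos (one_add_pow_four_pos y) (by positivity)).ne'))
  have hend : √2 * 1 / (1 + 1 ^ 2) = 1 / √2 := by
    rw [div_eq_div_iff (by norm_num) (by positivity)]
    linear_combination htwo
  rw [hend, mul_zero, zero_div] at hsubst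
  rw [← hsubst, ← intervalIntegral.integral_const_mul]
  refine intervalIntegral.integral_congr fun y _ => ?_
  have hpos := (one_add_pow_four_pos y).ne'
  simp only [Function.comp_apply, hsq]
  field_simp

theorem integral_one_div_two_sub_sq :
    ∫ y in (0 : ℝ)..1, 1 / (2 - y ^ 2) = (√2)⁻¹ * ∫ u in (0 : ℝ)..1 / √2, 1 / (1 - u ^ 2) := by
  have htwo : √2 ^ 2 = (2 : ℝ) := sq_sqrt zero_le_two
  have hscale := intervalIntegral.integral_comp_div (a := 0) (b := 1)
    (fun u : ℝ => 1 / (1 - u ^ 2)) (c := √2) (by positivity)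
  have hsq (y : ℝ) : 1 / (2 - y ^ 2) = 1 / 2 * (1 / (1 - (y / √2) ^ 2)) := by
    rw [div_pow, htwo, one_div_mul_one_div]
    congr 1
    ring
  simp only [hsq]
  rw [intervalIntegral.integral_const_mul, hscale, zero_div, smul_eq_mul, ← mul_assoc]
  congr 1
  field_simp
  rw [htwo]

theorem continuousOn_one_div_two_sub_sq :
    ContinuousOn (fun y : ℝ => 1 / (2 - y ^ 2)) (Icc 0 1) :=
  ContinuousOn.div (by fun_prop) (by fun_prop) fun y hy => (two_sub_sq_pos hy).ne'

theorem continuous_one_sub_sq_div_one_add_pow_four :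
    Continuous fun y : ℝ => (1 - y ^ 2) / (1 + y ^ 4) :=
  Continuous.div (by fun_prop) (by fun_prop) fun y => (one_add_pow_four_pos y).ne'

theorem continuousOn_nullWeight : ContinuousOn nullWeight (Icc 0 1) :=
  continuous_one_sub_sq_div_one_add_pow_four.continuousOn.sub continuousOn_one_div_two_sub_sq

theorem integral_nullWeight : ∫ y in (0 : ℝ)..1, nullWeight y = 0 := by
  simp only [nullWeight]
  rw [intervalIntegral.integral_sub
      (continuous_one_sub_sq_div_one_add_pow_four.intervalIntegrable 0 1)
      (continuousOn_one_div_two_sub_sq.intervalIntegrable_of_Icc zero_le_one),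
    integral_one_sub_sq_div_one_add_pow_four, integral_one_div_two_sub_sq, sub_self]

/-! ### Hermite reduction of the kernels -/

theorem integral_eq_of_hasDerivAt {R T : ℝ → ℝ} {β γ : ℝ} (hR : ContinuousOn R (Icc 0 1))
    (hT : ∀ y ∈ Icc (0 : ℝ) 1,
      HasDerivAt T (R y - (β * quarticWeight y + γ * nullWeight y)) y) :
    ∫ y in (0 : ℝ)..1, R y = T 1 - T 0 + β * (π / (2 * √2)) := by
  have hquartic := (continuous_quarticWeight.intervalIntegrable (μ := volume) 0 1).const_mul β
  have hnull := (continuousOn_nullWeight.intervalIntegrable_of_Icc zero_le_one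
    (μ := volume)).const_mul γ
  have hR' := hR.intervalIntegrable_of_Icc zero_le_one (μ := volume)
  have hftc := intervalIntegral.integral_eq_sub_of_hasDerivAt
    (fun y hy => hT y (by rwa [uIcc_of_le zero_le_one] at hy)) (hR'.sub (hquartic.add hnull))
  rw [intervalIntegral.integral_sub hR' (hquartic.add hnull),
    intervalIntegral.integral_add hquartic hnull, intervalIntegral.integral_const_mul,
    intervalIntegral.integral_const_mul, integral_quarticWeight, integral_nullWeight] at hftc
  linarith

theorem integral_mul_logFactor_of_hasDerivAt (c : ℝ) {α : ℝ} {R Q N M : ℝ → ℝ}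
    (hR : ContinuousOn R (Icc 0 1)) (hN : ContinuousOn N (Icc 0 1))
    (hM : ContinuousOn M (Icc 0 1))
    (hQ : ∀ y ∈ Ioo (0 : ℝ) 1, HasDerivAt Q (R y - α * quarticWeight y) y)
    (hQN : ∀ y ∈ Icc (0 : ℝ) 1, Q y = y * N y)
    (hQM : ∀ y ∈ Icc (0 : ℝ) 1, y * Q y - Q 1 = (1 - y ^ 2) * M y) :
    ∫ y in (0 : ℝ)..1, R y * logFactor c y =
      α * (3 / 2 * c * log 2 * (π / (2 * √2)) - (2 - c) * LTwoNegEight) -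
        2 * ∫ y in (0 : ℝ)..1, (N y + c * M y) := by
  have hR' : IntervalIntegrable (fun y => R y * logFactor c y) volume 0 1 :=
    (intervalIntegrable_logFactor c).continuousOn_mul (by rwa [uIcc_of_le zero_le_one])
  have hquartic := ((intervalIntegrable_logFactor c).continuousOn_mul
    continuous_quarticWeight.continuousOn).const_mul α
  have hparts := integral_deriv_mul_logFactor c
    (hR.sub (continuous_quarticWeight.continuousOn.const_mul α)) hN hM hQ hQN hQM
  simp only [Pi.sub_apply, sub_mul, mul_assoc] at hparts
  rw [intervalIntegral.integral_sub hR' hquartic, intervalIntegral.integral_const_mul,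
    integral_quarticWeight_mul_logFactor] at hparts
  linarith

theorem integral_mul_logFactor_add_integral {c α β γ : ℝ} {R C Q N M T : ℝ → ℝ}
    (hR : ContinuousOn R (Icc 0 1)) (hC : ContinuousOn C (Icc 0 1))
    (hN : ContinuousOn N (Icc 0 1)) (hM : ContinuousOn M (Icc 0 1))
    (hQ : ∀ y ∈ Ioo (0 : ℝ) 1, HasDerivAt Q (R y - α * quarticWeight y) y)
    (hQN : ∀ y ∈ Icc (0 : ℝ) 1, Q y = y * N y)
    (hQM : ∀ y ∈ Icc (0 : ℝ) 1, y * Q y - Q 1 = (1 - y ^ 2) * M y)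
    (hT : ∀ y ∈ Icc (0 : ℝ) 1, HasDerivAt T
      (C y - 2 * (N y + c * M y) - (β * quarticWeight y + γ * nullWeight y)) y) :
    (∫ y in (0 : ℝ)..1, R y * logFactor c y) + ∫ y in (0 : ℝ)..1, C y =
      α * (3 / 2 * c * log 2 * (π / (2 * √2)) - (2 - c) * LTwoNegEight) +
        (T 1 - T 0 + β * (π / (2 * √2))) := by
  have hNM : ContinuousOn (fun y => 2 * (N y + c * M y)) (Icc 0 1) :=
    (hN.add (hM.const_mul c)).const_mul 2
  rw [← integral_eq_of_hasDerivAt (R := fun y => C y - 2 * (N y + c * M y)) (hC.sub hNM) hT,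
    integral_mul_logFactor_of_hasDerivAt c hR hN hM hQ hQN hQM,
    intervalIntegral.integral_sub (hC.intervalIntegrable_of_Icc zero_le_one)
      (hNM.intervalIntegrable_of_Icc zero_le_one), intervalIntegral.integral_const_mul]
  ring

theorem hasDerivAt_sexticDenom (y : ℝ) :
    HasDerivAt sexticDenom (-2 * y + 8 * y ^ 3 - 6 * y ^ 5) y := by
  refine (((hasDerivAt_pow 2 y).const_sub 2).mul ((hasDerivAt_pow 4 y).const_add 1)).congr_deriv ?_
  push_cast
  ring

/-- The rational part of an antiderivative of `sumKernel (-7) 50 0`, found by Hermite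
reduction. -/
noncomputable def linearPrimitive (y : ℝ) : ℝ :=
  y * ((-16 + 60 * y ^ 2 - 36 * y ^ 4) / sexticDenom y ^ 1)

/-- The rational part of an antiderivative of `sumKernel 0 (-367) 700`, found by Hermite
reduction. -/
noncomputable def quadraticPrimitive (y : ℝ) : ℝ :=
  y * ((-240 + 1048 * y ^ 2 - 740 * y ^ 4 + 268 * y ^ 6 - 220 * y ^ 8 + 60 * y ^ 10) /
    sexticDenom y ^ 2)

theorem hasDerivAt_linearPrimitive {y : ℝ} (hy : y ∈ Icc (0 : ℝ) 1) :
    HasDerivAt linearPrimitive (sumKernel (-7) 50 0 y - 8 * quarticWeight y) y := by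
  have hquartic := (one_add_pow_four_pos y).ne'
  have htwo_sub := (two_sub_sq_pos hy).ne'
  have hnum : HasDerivAt (fun y : ℝ => -16 + 60 * y ^ 2 - 36 * y ^ 4)
      (120 * y - 144 * y ^ 3) y := by
    refine ((((hasDerivAt_pow 2 y).const_mul 60).const_add (-16)).sub
      ((hasDerivAt_pow 4 y).const_mul 36)).congr_deriv ?_
    push_cast
    ring
  refine ((hasDerivAt_id' y).mul (hnum.div ((hasDerivAt_sexticDenom y).pow 1)
    (pow_ne_zero 1 (sexticDenom_pos hy).ne'))).congr_deriv ?_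
  simp only [sumKernel, quarticWeight, sexticDenom, Pi.div_apply, Pi.pow_apply]
  field_simp
  ring

theorem hasDerivAt_quadraticPrimitive {y : ℝ} (hy : y ∈ Icc (0 : ℝ) 1) :
    HasDerivAt quadraticPrimitive (sumKernel 0 (-367) 700 y - 60 * quarticWeight y) y := by
  have hquartic := (one_add_pow_four_pos y).ne'
  have htwo_sub := (two_sub_sq_pos hy).ne'
  have hnum : HasDerivAt (fun y : ℝ => -240 + 1048 * y ^ 2 - 740 * y ^ 4 + 268 * y ^ 6 -
      220 * y ^ 8 + 60 * y ^ 10)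
      (2096 * y - 2960 * y ^ 3 + 1608 * y ^ 5 - 1760 * y ^ 7 + 600 * y ^ 9) y := by
    refine (((((((hasDerivAt_pow 2 y).const_mul 1048).const_add (-240)).sub
      ((hasDerivAt_pow 4 y).const_mul 740)).add ((hasDerivAt_pow 6 y).const_mul 268)).sub
      ((hasDerivAt_pow 8 y).const_mul 220)).add ((hasDerivAt_pow 10 y).const_mul 60)).congr_deriv ?_
    push_cast
    ring
  refine ((hasDerivAt_id' y).mul (hnum.div ((hasDerivAt_sexticDenom y).pow 2)
    (pow_ne_zero 2 (sexticDenom_pos hy).ne'))).congr_deriv ?_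
  simp only [sumKernel, quarticWeight, sexticDenom, Pi.div_apply, Pi.pow_apply]
  field_simp
  ring

theorem linearPrimitive_one : linearPrimitive 1 = 4 := by
  norm_num [linearPrimitive, sexticDenom]

theorem quadraticPrimitive_one : quadraticPrimitive 1 = 44 := by
  norm_num [quadraticPrimitive, sexticDenom]

theorem mul_linearPrimitive_sub {y : ℝ} (hy : y ∈ Icc (0 : ℝ) 1) :
    y * linearPrimitive y - 4 =
      (1 - y ^ 2) * ((-8 - 20 * y ^ 2 + 32 * y ^ 4) / sexticDenom y ^ 1) := by
  have hquartic := (one_add_pow_four_pos y).ne'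
  have htwo_sub := (two_sub_sq_pos hy).ne'
  simp only [linearPrimitive, sexticDenom]
  field_simp
  ring

theorem mul_quadraticPrimitive_sub {y : ℝ} (hy : y ∈ Icc (0 : ℝ) 1) :
    y * quadraticPrimitive y - 44 =
      (1 - y ^ 2) * ((-176 - 240 * y ^ 2 + 412 * y ^ 4 + 24 * y ^ 6 + 28 * y ^ 8 - 16 * y ^ 10) /
        sexticDenom y ^ 2) := by
  have hquartic := (one_add_pow_four_pos y).ne'
  have htwo_sub := (two_sub_sq_pos hy).ne'
  simp only [quadraticPrimitive, sexticDenom]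
  field_simp
  ring

theorem hasDerivAt_quintic_div_sexticDenom (a b c : ℝ) {y : ℝ} (hy : y ∈ Icc (0 : ℝ) 1) :
    HasDerivAt (fun y => (a * y + b * y ^ 3 + c * y ^ 5) / sexticDenom y)
      (((a + 3 * b * y ^ 2 + 5 * c * y ^ 4) * sexticDenom y -
        (a * y + b * y ^ 3 + c * y ^ 5) * (-2 * y + 8 * y ^ 3 - 6 * y ^ 5)) /
          sexticDenom y ^ 2) y := by
  have hnum : HasDerivAt (fun y : ℝ => a * y + b * y ^ 3 + c * y ^ 5)
      (a + 3 * b * y ^ 2 + 5 * c * y ^ 4) y := by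
    refine ((((hasDerivAt_id' y).const_mul a).add ((hasDerivAt_pow 3 y).const_mul b)).add
      ((hasDerivAt_pow 5 y).const_mul c)).congr_deriv ?_
    push_cast
    ring
  exact hnum.div (hasDerivAt_sexticDenom y) (sexticDenom_pos hy).ne'

theorem integral_sumKernel_quadratic :
    ∫ y in (0 : ℝ)..1, sumKernel 0 (-367) 700 y = 44 + 60 * (π / (2 * √2)) := by
  rw [integral_eq_of_hasDerivAt (β := 60) (γ := 0) (continuousOn_sumKernel _ _ _)
    fun y hy => (hasDerivAt_quadraticPrimitive hy).congr_deriv (by ring), quadraticPrimitive_one]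
  simp [quadraticPrimitive]

theorem integral_linear (c : ℝ) :
    (∫ y in (0 : ℝ)..1, sumKernel (-7) 50 0 y * logFactor c y) +
        ∫ y in (0 : ℝ)..1, sumKernel (20 - 15 * c) 0 0 y =
      8 * (3 / 2 * c * log 2 * (π / (2 * √2)) - (2 - c) * LTwoNegEight) +
        (4 * c + 8) * (π / (2 * √2)) := by
  rw [integral_mul_logFactor_add_integral (T := fun _ => 0) (β := 4 * c + 8) (γ := 8 * c + 16)
    (continuousOn_sumKernel _ _ _) (continuousOn_sumKernel _ _ _)
    (continuousOn_div_sexticDenom_pow (f := fun y => -16 + 60 * y ^ 2 - 36 * y ^ 4)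
      (by fun_prop) 1)
    (continuousOn_div_sexticDenom_pow (f := fun y => -8 - 20 * y ^ 2 + 32 * y ^ 4)
      (by fun_prop) 1)
    (fun y hy => hasDerivAt_linearPrimitive (Ioo_subset_Icc_self hy)) (fun _ _ => rfl)
    (fun y hy => by rw [linearPrimitive_one, mul_linearPrimitive_sub hy])
    fun y hy => (hasDerivAt_const y (0 : ℝ)).congr_deriv ?_, sub_self, zero_add]
  have hquartic := (one_add_pow_four_pos y).ne'
  have htwo_sub := (two_sub_sq_pos hy).ne'
  simp only [sumKernel, quarticWeight, nullWeight, sexticDenom]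
  field_simp
  ring

theorem integral_quadratic (c : ℝ) :
    (∫ y in (0 : ℝ)..1, sumKernel 0 (-367) 700 y * logFactor c y) +
        ∫ y in (0 : ℝ)..1, sumKernel 0 ((8500 - 1825 * c) / 21) 0 y =
      60 * (3 / 2 * c * log 2 * (π / (2 * √2)) - (2 - c) * LTwoNegEight) +
        ((680 + 148 * c) / 21 + (612 + 374 * c) / 7 * (π / (2 * √2))) := by
  -- `T`, `β` and `γ` are solved for as functions of `c` by Hermite reduction.
  rw [integral_mul_logFactor_add_integral (β := (612 + 374 * c) / 7) (γ := (248 + 124 * c) / 3)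
    (T := fun y => ((-368 + 584 * c) / 21 * y + (2028 + 54 * c) / 7 * y ^ 3 +
      (-1452 - 150 * c) / 7 * y ^ 5) / sexticDenom y)
    (continuousOn_sumKernel _ _ _) (continuousOn_sumKernel _ _ _)
    (continuousOn_div_sexticDenom_pow (f := fun y => -240 + 1048 * y ^ 2 - 740 * y ^ 4 +
      268 * y ^ 6 - 220 * y ^ 8 + 60 * y ^ 10) (by fun_prop) 2)
    (continuousOn_div_sexticDenom_pow (f := fun y => -176 - 240 * y ^ 2 + 412 * y ^ 4 +
      24 * y ^ 6 + 28 * y ^ 8 - 16 * y ^ 10) (by fun_prop) 2)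
    (fun y hy => hasDerivAt_quadraticPrimitive (Ioo_subset_Icc_self hy)) (fun _ _ => rfl)
    (fun y hy => by rw [quadraticPrimitive_one, mul_quadraticPrimitive_sub hy])
    fun y hy => (hasDerivAt_quintic_div_sexticDenom _ _ _ hy).congr_deriv ?_]
  · norm_num [sexticDenom]
    ring
  · have hquartic := (one_add_pow_four_pos y).ne'
    have htwo_sub := (two_sub_sq_pos hy).ne'
    simp only [sumKernel, quarticWeight, nullWeight, sexticDenom]
    field_simp
    ring

/-! ### The series -/

theorem pi_div_two_mul_sqrt_two : π / (2 * √2) = √2 * π / 4 := by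
  linear_combination (-π / 2) * sqrt_div_self (x := 2)

theorem hasSum_binomWeight :
    HasSum (fun k : ℕ => (350 * (k : ℝ) - 17) * binomWeight k) (15 * √2 * π + 27) := by
  have h := hasSum_quadCoeff_mul_binomWeight 0 (-367) 700
  rw [integral_sumKernel_quadratic, pi_div_two_mul_sqrt_two] at h
  have hvalue : 15 * √2 * π + 27 -
      ∑ k ∈ Finset.range 1, (350 * (k : ℝ) - 17) * binomWeight k = 44 + 60 * (√2 * π / 4) := by
    norm_num [binomWeight]
    ring
  refine (hasSum_nat_add_iff' 1).mp ?_
  rw [hvalue]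
  refine h.congr_fun fun k => ?_
  have hk : (k : ℝ) + 1 ≠ 0 := by positivity
  rw [quadCoeff]
  push_cast
  field_simp
  ring

theorem hasSum_binomWeight_div_mul_harmonicFactor (c : ℝ) :
    HasSum (fun k : ℕ => ((50 * ((k : ℝ) + 1) - 7) * harmonicFactor c (k + 1) + (20 - 15 * c)) /
        ((k : ℝ) + 1) * binomWeight (k + 1))
      (√2 * π * (c + 2 + 3 * c * log 2) - 8 * (2 - c) * LTwoNegEight) := by
  have h := (hasSum_quadCoeff_mul_binomWeight_mul_harmonicFactor (-7) 50 0 c).add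
    (hasSum_quadCoeff_mul_binomWeight (20 - 15 * c) 0 0)
  have hvalue : √2 * π * (c + 2 + 3 * c * log 2) - 8 * (2 - c) * LTwoNegEight =
      8 * (3 / 2 * c * log 2 * (π / (2 * √2)) - (2 - c) * LTwoNegEight) +
        (4 * c + 8) * (π / (2 * √2)) := by
    rw [pi_div_two_mul_sqrt_two]
    ring
  rw [hvalue, ← integral_linear]
  refine h.congr_fun fun k => ?_
  rw [quadCoeff, quadCoeff]
  ring

theorem hasSum_binomWeight_mul_harmonicFactor (c : ℝ) :
    HasSum (fun k : ℕ => (21 * (350 * ((k : ℝ) + 1) - 17) * harmonicFactor c (k + 1) +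
        (8500 - 1825 * c)) * binomWeight (k + 1))
      (680 + 148 * c + 3 / 2 * (306 + 187 * c) * √2 * π + 945 / 2 * c * √2 * π * log 2 -
        1260 * (2 - c) * LTwoNegEight) := by
  have h := ((hasSum_quadCoeff_mul_binomWeight_mul_harmonicFactor 0 (-367) 700 c).add
    (hasSum_quadCoeff_mul_binomWeight 0 ((8500 - 1825 * c) / 21) 0)).mul_left 21
  have hvalue : 680 + 148 * c + 3 / 2 * (306 + 187 * c) * √2 * π + 945 / 2 * c * √2 * π * log 2 -
      1260 * (2 - c) * LTwoNegEight =
      21 * (60 * (3 / 2 * c * log 2 * (π / (2 * √2)) - (2 - c) * LTwoNegEight) +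
        ((680 + 148 * c) / 21 + (612 + 374 * c) / 7 * (π / (2 * √2)))) := by
    rw [pi_div_two_mul_sqrt_two]
    ring
  rw [hvalue, ← integral_quadratic]
  refine h.congr_fun fun k => ?_
  have hk : (k : ℝ) + 1 ≠ 0 := by positivity
  rw [quadCoeff, quadCoeff]
  field_simp
  ring

theorem mainTheorem1 :
    HasSum (fun k : ℕ => (350 * (k : ℝ) - 17) * binomWeight k)
      (15 * √2 * Real.pi + 27) ∧
    HasSum (fun k : ℕ+ =>
        (21 * (350 * ((k : ℕ) : ℝ) - 17) * (2 * Hnum (6 * k - 1) - Hnum (3 * k - 1) - Hnum (k - 1)) + 4850)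
          * binomWeight k)
      (976 + 1020 * √2 * Real.pi + 945 * √2 * Real.pi * Real.log 2) ∧
    HasSum (fun k : ℕ+ =>
        (7 * (350 * ((k : ℕ) : ℝ) - 17) * (Hnum (2 * k - 1) - Hnum (k - 1)) + 2225) * binomWeight k)
      (276 + 493 * Real.pi / √2 + 315 * Real.pi * Real.log 2 / √2 - 420 * LTwoNegEight) ∧
    HasSum (fun k : ℕ+ =>
        ((50 * ((k : ℕ) : ℝ) - 7) * (Hnum (2 * k - 1) - Hnum (k - 1)) + 5) / ((k : ℕ) : ℝ)
          * binomWeight k)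
      (3 * √2 * Real.pi * (1 + Real.log 2) - 8 * LTwoNegEight) ∧
    HasSum (fun k : ℕ+ =>
        ((50 * ((k : ℕ) : ℝ) - 7) * (2 * Hnum (6 * k - 1) - Hnum (3 * k - 1) - Hnum (k - 1)) - 10)
          / ((k : ℕ) : ℝ) * binomWeight k)
      (2 * √2 * Real.pi * (2 + 3 * Real.log 2)) := by
  refine ⟨hasSum_binomWeight, hasSum_pnat_of_succ ?_, hasSum_pnat_of_succ ?_,
    hasSum_pnat_of_succ ?_, hasSum_pnat_of_succ ?_⟩ <;>
  simp only [Nat.succPNat_coe, Nat.succ_eq_add_one, Nat.add_sub_cancel, Nat.cast_add, Nat.cast_one,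
    ← harmonicFactor_one_succ, ← harmonicFactor_two_succ]
  · convert hasSum_binomWeight_mul_harmonicFactor 2 using 1
    · ext k
      ring
    · ring
  · convert (hasSum_binomWeight_mul_harmonicFactor 1).div_const 3 using 1
    · rfl
    · ext k
      ring
    · linear_combination (-(493 + 315 * log 2) * π) * sqrt_div_self (x := 2)
  · convert hasSum_binomWeight_div_mul_harmonicFactor 1 using 1
    · ext k
      ring
    · ring
  · convert hasSum_binomWeight_div_mul_harmonicFactor 2 using 1
    · ext k
      ring
    · ring
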